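/- Let $q=q(n)\in[0,1]$ satisfy $n^{-1}\log n \ll q \ll n^{-2/3}$ as $n\to\infty$ (where $f\ll g$ means $f=o(g)$), and let $G\sim G(n,q)$ be the binomial random graph on $n$ vertices with edge probability $q$. A triangle-matching in a graph is a collection of pairwise vertex-disjoint triangles. For each graph $H$ let $s(H)$ be the maximum number of triangles in a triangle-matching of $H$, and let $S(H)$ be the set of vertices covered by a triangle-matching with $s(H)$ triangles; if there are several such triangle-matchings, one of them is chosen by an arbitrary deterministic rule. Then, with high probability (that is, with probability tending to $1$ as $n\to\infty$), the graph $G-S(G)$ induced by $G$ on the vertices outside $S(G)$ has a near-perfect matching, i.e. a matching that covers all but at most one of its vertices. Moreover, let $G'\sim G(n,1-q)$, and let $\overline{G'}$ be its complement, so that $\overline{G'}\sim G(n,q)$. Then, with high probability, $$\chi(G') = \left\lceil \frac{n-s(\overline{G'})}{2}\right\rceil .$$ -/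

import Mathlib

open Filter Topology Asymptotics

namespace SimpleGraph

/-- A triangle-matching in `H`: a (finite) collection of pairwise vertex-disjoint triangles of `H`,
each triangle being given by its set of three vertices. -/
def IsTriangleMatching {V : Type*} (H : SimpleGraph V) (M : Finset (Finset V)) : Prop :=
  (∀ T ∈ M, H.IsNClique 3 T) ∧ (M : Set (Finset V)).Pairwise fun T T' => Disjoint T T'

/-- A triangle-matching with the largest possible number of triangles. -/
def IsMaximumTriangleMatching {V : Type*} (H : SimpleGraph V) (M : Finset (Finset V)) : Prop :=
  H.IsTriangleMatching M ∧ ∀ M' : Finset (Finset V), H.IsTriangleMatching M' → M'.card ≤ M.card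

/-- `S` is the set of vertices covered by some maximum triangle-matching of `H`. -/
def IsMaximumTriangleMatchingVerts {V : Type*} (H : SimpleGraph V) (S : Set V) : Prop :=
  ∃ M : Finset (Finset V), H.IsMaximumTriangleMatching M ∧ S = {v | ∃ T ∈ M, v ∈ T}

open Classical in
/-- `s(H)`: the maximum number of pairwise vertex-disjoint triangles in the finite graph `H`. -/
noncomputable def triangleMatchingNumber {V : Type*} [Fintype V] (H : SimpleGraph V) : ℕ :=
  (Finset.univ.filter fun M : Finset (Finset V) => H.IsTriangleMatching M).sup Finset.card

/-- `H` has a matching that misses at most one vertex of `H`. (The vertices of a subgraph `M` with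
`M.IsMatching` are exactly the endpoints of the edges of the matching.) -/
def HasNearPerfectMatching {V : Type*} (H : SimpleGraph V) : Prop :=
  ∃ M : H.Subgraph, M.IsMatching ∧ (M.vertsᶜ).Subsingleton

end SimpleGraph

/-!
Write `d = n q`, so that `log n ≪ d` and `n² q³ → 0`. Fix two disjoint sets `P₀`, `P₁` of `n / 3`
vertices each. With high probability, every vertex has more than `d / 8` neighbours in each `Pᵢ`;
no set `W` of at most `n / 64` vertices sends more than `d / 16` edges from each of its vertices
into a set that is disjoint from `W` and not larger; and there is an edge between any two disjoint
sets of at least `n / 64` vertices. These are Chernoff and union bounds, resting on the single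
estimate `binomialRandom_real_edgeCountIn_le_exp`.

A maximum triangle-matching might a priori cover the whole neighbourhood of some vertex `v` that it
leaves uncovered. But if it covers more than `d / 16` neighbours of `v`, then there are at least
`d / 48` disjoint triangles each joined to `v` by an edge, and the expected number of such families
is at most `(e · 3 n³ q⁴ / m) ^ m` with `m ≥ d / 48`, whose base is of order `n² q³ → 0`
(`binomialRandom_real_exists_degreeIn_isTriangleMatching_le`). This is where `q ≪ n^{-2/3}` enters;
it also gives that a triangle-matching covers at most a tenth of the vertices and that there is
no `K₄`. Since the argument applies to every triangle-matching, the rule that chooses `S` does not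
matter.

Hence after the deletion of `S` every remaining vertex keeps more than `d / 16` neighbours in each
`Pᵢ`. The remaining vertices can be split into two parts whose sizes differ by at most one, the
first containing what is left of `P₀` and the second what is left of `P₁`, and Hall's condition
holds for the smaller part (`exists_injOn_of_expansion`). Working with a
bipartition gives a near-perfect matching for both parities at once, without Tutte's theorem.

For the chromatic number, colour classes are cliques of the complement `G`. The triangles of a
maximum triangle-matching, the edges of the near-perfect matching and a possible single vertex are
`⌈(n - s(G)) / 2⌉` classes; conversely, without `K₄` every class has at most three vertices, and at
most `s(G)` classes have three (`chromaticNumber_compl_eq`).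
-/

/-! ### Edge counts of the binomial random graph -/

namespace SimpleGraph
open MeasureTheory ProbabilityTheory unitInterval

instance instMeasurableSingletonClass {V : Type*} [Countable V] :
    MeasurableSingletonClass (SimpleGraph V) where
  measurableSet_singleton G := by
    have h : ({G} : Set (SimpleGraph V)) = edgeSet ⁻¹' {G.edgeSet} := by ext H; simp
    rw [h]
    exact measurable_edgeSet (measurableSet_singleton _)

open Classical in
/-- The number of edges of `G` among the pairs in `F`. -/
noncomputable def edgeCountIn {V : Type*} (G : SimpleGraph V) (F : Finset (Sym2 V)) : ℕ :=
  (F.filter (· ∈ G.edgeSet)).card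

variable {V : Type*} [Fintype V]

theorem binomialRandom_real_edges_eq (p : I) {F K : Finset (Sym2 V)} (hK : K ⊆ F)
    (hF : ∀ e ∈ F, ¬ e.IsDiag) :
    (binomialRandom V p).real {G | ∀ e ∈ F, e ∈ G.edgeSet ↔ e ∈ K} =
      (p : ℝ) ^ K.card * (1 - (p : ℝ)) ^ (F.card - K.card) := by
  classical
  have h1 : (fromEdgeSet : Set (Sym2 V) → SimpleGraph V) ⁻¹'
      {G | ∀ e ∈ F, e ∈ G.edgeSet ↔ e ∈ K} = {s | ∀ e ∈ F, e ∈ s ↔ e ∈ K} := by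
    ext s
    simp only [Set.mem_preimage, Set.mem_ofPred_eq, edgeSet_fromEdgeSet]
    refine forall₂_congr fun e he => ?_
    have := hF e he
    simp [this]
  have h2 : ((fun p : Sym2 V → Prop ↦ {i | p i}) ⁻¹' {s | ∀ e ∈ F, e ∈ s ↔ e ∈ K}) =
      Set.pi (F : Set (Sym2 V)) (fun e => {b : Prop | b ↔ e ∈ K}) := by
    ext s; simp [Set.mem_pi]
  rw [measureReal_def, binomialRandom_eq_map,
    Measure.map_apply measurable_fromEdgeSet (Set.toFinite _).measurableSet, h1,
    setBernoulli_apply', h2, Measure.infinitePi_pi _ (fun _ _ => (Set.toFinite _).measurableSet)]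
  have h3 : ∀ e ∈ F, ((toNNReal p • Measure.dirac (e ∈ (Sym2.diagSetᶜ : Set (Sym2 V))) +
      toNNReal (σ p) • Measure.dirac False : Measure Prop) {b : Prop | b ↔ e ∈ K}) =
      if e ∈ K then (toNNReal p : ENNReal) else (toNNReal (σ p) : ENNReal) := by
    intro e he
    have := hF e he
    by_cases h : e ∈ K <;> simp [this, h]
  rw [Finset.prod_congr rfl h3, Finset.prod_ite, Finset.filter_mem_eq_inter,
    Finset.inter_eq_right.2 hK, Finset.filter_notMem_eq_sdiff]
  simp [Finset.card_sdiff_of_subset hK]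

theorem binomialRandom_real_subset_edgeSet (p : I) {F : Finset (Sym2 V)}
    (hF : ∀ e ∈ F, ¬ e.IsDiag) :
    (binomialRandom V p).real {G | ∀ e ∈ F, e ∈ G.edgeSet} = (p : ℝ) ^ F.card := by
  have := binomialRandom_real_edges_eq p (F := F) (K := F) subset_rfl hF
  simp only [Nat.sub_self, pow_zero, mul_one] at this
  rw [← this]
  congr 1
  ext G
  exact forall₂_congr fun e he => by simp [he]

/-- Chernoff bound for the number of edges in a prescribed set of pairs: positive `l` gives an
upper tail estimate, negative `l` a lower tail estimate. -/
theorem binomialRandom_real_edgeCountIn_le_exp (p : I) {F : Finset (Sym2 V)}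
    (hF : ∀ e ∈ F, ¬ e.IsDiag) (l c : ℝ) :
    (binomialRandom V p).real {G | c ≤ l * G.edgeCountIn F} ≤
      Real.exp (-c + (Real.exp l - 1) * (p * F.card)) := by
  classical
  set Q := F.powerset.filter (fun K => c ≤ l * K.card) with hQ
  have hp0 : (0 : ℝ) ≤ p := p.2.1
  have hp1 : (0 : ℝ) ≤ 1 - p := sub_nonneg.2 p.2.2
  have hsub : {G : SimpleGraph V | c ≤ l * G.edgeCountIn F} ⊆
      ⋃ K ∈ Q, {G | ∀ e ∈ F, e ∈ G.edgeSet ↔ e ∈ K} := by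
    intro G hG
    simp only [Set.mem_iUnion]
    refine ⟨F.filter (· ∈ G.edgeSet), ?_, ?_⟩
    · simp only [hQ, Finset.mem_filter, Finset.mem_powerset, Finset.filter_subset, true_and]
      simpa [edgeCountIn] using hG
    · intro e he
      simp [he]
  calc (binomialRandom V p).real {G | c ≤ l * G.edgeCountIn F}
      ≤ (binomialRandom V p).real (⋃ K ∈ Q, {G | ∀ e ∈ F, e ∈ G.edgeSet ↔ e ∈ K}) :=
        measureReal_mono hsub (measure_ne_top _ _)
    _ ≤ ∑ K ∈ Q, (binomialRandom V p).real {G | ∀ e ∈ F, e ∈ G.edgeSet ↔ e ∈ K} :=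
        measureReal_biUnion_finset_le _ _
    _ ≤ ∑ K ∈ Q, Real.exp (-c) * ((p * Real.exp l) ^ K.card *
          (1 - (p : ℝ)) ^ (F.card - K.card)) := by
        refine Finset.sum_le_sum fun K hK => ?_
        simp only [hQ, Finset.mem_filter, Finset.mem_powerset] at hK
        rw [binomialRandom_real_edges_eq p hK.1 hF, mul_pow, ← Real.exp_nat_mul]
        have h1 : 1 ≤ Real.exp (-c) * Real.exp (K.card * l) := by
          rw [← Real.exp_add]
          exact Real.one_le_exp (by linarith [hK.2, mul_comm l K.card])
        have h2 : 0 ≤ (p : ℝ) ^ K.card * (1 - (p : ℝ)) ^ (F.card - K.card) := by positivity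
        nlinarith [mul_le_mul_of_nonneg_right h1 h2]
    _ ≤ ∑ K ∈ F.powerset, Real.exp (-c) * ((p * Real.exp l) ^ K.card *
          (1 - (p : ℝ)) ^ (F.card - K.card)) :=
        Finset.sum_le_sum_of_subset_of_nonneg (Finset.filter_subset _ _)
          fun _ _ _ => by positivity
    _ = Real.exp (-c) * (p * Real.exp l + (1 - p)) ^ F.card := by
        rw [← Finset.mul_sum, Finset.sum_pow_mul_eq_add_pow]
    _ ≤ Real.exp (-c) * Real.exp (p * Real.exp l - p) ^ F.card := by
        gcongr
        linarith [Real.add_one_le_exp (p * Real.exp l - p : ℝ)]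
    _ = _ := by
        rw [← Real.exp_nat_mul, ← Real.exp_add]
        ring_nf

theorem exp_neg_one_sub_one_le : Real.exp (-1) - 1 ≤ -(63 / 100) := by
  have h := Real.exp_one_gt_d9
  have h1 : Real.exp (-1) * Real.exp 1 = 1 := by rw [← Real.exp_add]; simp
  nlinarith [Real.exp_pos (-1)]

theorem binomialRandom_real_edgeCountIn_ge_le_exp (p : I) {F : Finset (Sym2 V)}
    (hF : ∀ e ∈ F, ¬ e.IsDiag) (c : ℝ) :
    (binomialRandom V p).real {G | c ≤ G.edgeCountIn F} ≤
      Real.exp (-c + 2 * (p * F.card)) := by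
  have h := binomialRandom_real_edgeCountIn_le_exp p hF 1 c
  simp only [one_mul] at h
  refine h.trans (Real.exp_le_exp.2 ?_)
  have h1 := Real.exp_one_lt_d9
  have h2 : (0 : ℝ) ≤ p * F.card := mul_nonneg p.2.1 (Nat.cast_nonneg _)
  nlinarith

theorem binomialRandom_real_edgeCountIn_le_le_exp (p : I) {F : Finset (Sym2 V)}
    (hF : ∀ e ∈ F, ¬ e.IsDiag) (c : ℝ) :
    (binomialRandom V p).real {G | (G.edgeCountIn F : ℝ) ≤ c} ≤
      Real.exp (c - 63 / 100 * (p * F.card)) := by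
  have h := binomialRandom_real_edgeCountIn_le_exp p hF (-1) (-c)
  simp only [neg_mul, one_mul, neg_le_neg_iff, neg_neg] at h
  refine h.trans (Real.exp_le_exp.2 ?_)
  have h2 : (0 : ℝ) ≤ p * F.card := mul_nonneg p.2.1 (Nat.cast_nonneg _)
  nlinarith [exp_neg_one_sub_one_le]

open Classical in
/-- First-moment bound for many edge-disjoint copies: if each `i ∈ J` carries a set `F i` of `k`
pairs, then `m` pairwise disjoint ones of these sets are unlikely to be all present. The bound uses
`|J|.choose m ≤ |J| ^ m / m! ≤ (e |J| / m) ^ m`. -/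
theorem binomialRandom_real_exists_disjoint_le (p : I) {ι : Type*} (J : Finset ι)
    (F : ι → Finset (Sym2 V)) (k m : ℕ) (hm : 0 < m) (hF : ∀ i ∈ J, ∀ e ∈ F i, ¬ e.IsDiag)
    (hk : ∀ i ∈ J, (F i).card = k) :
    (binomialRandom V p).real {G | ∃ K ⊆ J, K.card = m ∧
      (K : Set ι).PairwiseDisjoint F ∧ ∀ i ∈ K, ∀ e ∈ F i, e ∈ G.edgeSet} ≤
      (Real.exp 1 * (J.card * (p : ℝ) ^ k) / m) ^ m := by
  have hp0 : (0 : ℝ) ≤ p := p.2.1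
  set Q := (J.powersetCard m).filter (fun K : Finset ι => (K : Set ι).PairwiseDisjoint F) with hQ
  have hsub : {G : SimpleGraph V | ∃ K ⊆ J, K.card = m ∧
      (K : Set ι).PairwiseDisjoint F ∧ ∀ i ∈ K, ∀ e ∈ F i, e ∈ G.edgeSet} ⊆
      ⋃ K ∈ Q, {G | ∀ e ∈ K.biUnion F, e ∈ G.edgeSet} := by
    rintro G ⟨K, hKJ, hKm, hKd, hKe⟩
    simp only [Set.mem_iUnion]
    refine ⟨K, by simp [hQ, hKJ, hKm, hKd], ?_⟩
    simp only [Finset.mem_biUnion, Set.mem_ofPred_eq]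
    rintro e ⟨i, hi, he⟩
    exact hKe i hi e he
  calc _ ≤ (binomialRandom V p).real (⋃ K ∈ Q, {G | ∀ e ∈ K.biUnion F, e ∈ G.edgeSet}) :=
        measureReal_mono hsub (measure_ne_top _ _)
    _ ≤ ∑ K ∈ Q, (binomialRandom V p).real {G | ∀ e ∈ K.biUnion F, e ∈ G.edgeSet} :=
        measureReal_biUnion_finset_le _ _
    _ = ∑ K ∈ Q, (p : ℝ) ^ (m * k) := by
        refine Finset.sum_congr rfl fun K hK => ?_
        simp only [hQ, Finset.mem_filter, Finset.mem_powersetCard] at hK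
        obtain ⟨⟨hKJ, hKm⟩, hKd⟩ := hK
        rw [binomialRandom_real_subset_edgeSet, Finset.card_biUnion hKd,
          Finset.sum_congr rfl (fun i hi => hk i (hKJ hi)), Finset.sum_const, hKm, smul_eq_mul]
        intro e he
        obtain ⟨i, hi, he⟩ := Finset.mem_biUnion.1 he
        exact hF i (hKJ hi) e he
    _ ≤ (J.card.choose m : ℝ) * (p : ℝ) ^ (m * k) := by
        rw [Finset.sum_const, nsmul_eq_mul]
        gcongr
        rw [← Finset.card_powersetCard]
        exact Finset.card_filter_le _ _
    _ ≤ ((J.card : ℝ) ^ m / m.factorial) * (p : ℝ) ^ (m * k) := by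
        gcongr
        exact Nat.choose_le_pow_div m J.card
    _ ≤ ((J.card : ℝ) ^ m * (Real.exp m / (m : ℝ) ^ m)) * (p : ℝ) ^ (m * k) := by
        gcongr
        have hmf : (0 : ℝ) < m.factorial := by positivity
        have := Real.pow_div_factorial_le_exp (m : ℝ) (by positivity) m
        rw [div_le_iff₀ hmf] at this
        rw [div_eq_mul_inv]
        gcongr
        rw [le_div_iff₀ (by positivity), inv_mul_le_iff₀ hmf]
        linarith
    _ = _ := by
        rw [div_pow, mul_pow, mul_pow, ← pow_mul, mul_comm k m, ← Real.exp_nat_mul, mul_one]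
        ring

/-- The complement of `G(V, 1 - p)` is distributed as `G(V, p)`. -/
theorem binomialRandom_symm_compl (p : I) (A : Set (SimpleGraph V)) :
    binomialRandom V (σ p) {H | Hᶜ ∈ A} = binomialRandom V p A := by
  classical
  have h : ∀ (r : I) (B : Set (SimpleGraph V)), binomialRandom V r B =
      ∑ G : SimpleGraph V, if G ∈ B then binomialRandom V r {G} else 0 := by
    intro r B
    rw [← Finset.sum_filter, sum_measure_singleton]
    congr 1
    ext; simp
  rw [h, h]
  refine Fintype.sum_equiv (Equiv.mk compl compl compl_compl compl_compl) _ _ fun G => ?_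
  simp only [Set.mem_ofPred_eq, Equiv.coe_fn_mk]
  refine if_congr Iff.rfl ?_ rfl
  have hcard : G.edgeSet.ncard + Gᶜ.edgeSet.ncard = (Nat.card V).choose 2 := by
    rw [← Set.ncard_union_eq (by simpa using (disjoint_compl_right (a := G))),
      ← edgeSet_sup, sup_compl_eq_top, Nat.card_eq_fintype_card,
      ← card_edgeFinset_top_eq_card_choose_two, ← Set.ncard_coe_finset, coe_edgeFinset]
  rw [binomialRandom_singleton, binomialRandom_singleton, mul_comm, ← hcard]
  simp

end SimpleGraph

/-! ### Near-perfect matchings from expansion -/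

namespace SimpleGraph

open Classical in
/-- The number of neighbours of `v` in `A`. -/
noncomputable def degreeIn {V : Type*} (G : SimpleGraph V) (v : V) (A : Finset V) : ℕ :=
  (A.filter (G.Adj v)).card

section
variable {V : Type*} {G : SimpleGraph V}

theorem degreeIn_mono {v : V} {A B : Finset V} (h : A ⊆ B) : G.degreeIn v A ≤ G.degreeIn v B := by
  classical
  exact Finset.card_le_card (Finset.filter_subset_filter _ h)

theorem degreeIn_le_add_sdiff [DecidableEq V] (v : V) (A B : Finset V) :
    G.degreeIn v A ≤ G.degreeIn v B + G.degreeIn v (A \ B) := by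
  classical
  refine le_trans (Finset.card_le_card ?_) (Finset.card_union_le _ _)
  intro x
  simp only [Finset.mem_filter, Finset.mem_union, Finset.mem_sdiff]
  tauto

theorem hasNearPerfectMatching_induce_of_injOn [DecidableEq V] {s : Set V} {A B : Finset V}
    (hs : s = ↑(A ∪ B)) (hd : Disjoint A B) (hcard : A.card ≤ B.card + 1) {f : V → V}
    (hf : Set.InjOn f B) (hfA : ∀ b ∈ B, f b ∈ A ∧ G.Adj b (f b)) :
    (G.induce s).HasNearPerfectMatching := by
  have hms : ∀ v, v ∈ s ↔ v ∈ A ∪ B := fun v => by simp [hs]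
  have hBA : ∀ b ∈ B, b ∉ A := fun b hb ha => Finset.disjoint_left.1 hd ha hb
  let M : (G.induce s).Subgraph :=
    { verts := {x | (x : V) ∈ B ∨ ∃ b ∈ B, f b = x}
      Adj := fun x y => ((x : V) ∈ B ∧ f x = y) ∨ ((y : V) ∈ B ∧ f y = x)
      adj_sub := by
        rintro x y (⟨hx, hxy⟩ | ⟨hy, hxy⟩)
        · have h := (hfA x hx).2
          rw [hxy] at h
          exact h
        · have h := (hfA y hy).2
          rw [hxy] at h
          exact h.symm
      edge_vert := by
        rintro x y (⟨hx, hxy⟩ | ⟨hy, hxy⟩)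
        · exact Or.inl hx
        · exact Or.inr ⟨y, hy, hxy⟩
      symm := ⟨fun x y h => Or.symm h⟩ }
  refine ⟨M, ?_, ?_⟩
  · rintro x (hx | ⟨b, hb, hbx⟩)
    · have hm : f x ∈ s := (hms _).2 (Finset.mem_union_left _ (hfA x hx).1)
      refine ⟨⟨f x, hm⟩, Or.inl ⟨hx, rfl⟩, ?_⟩
      rintro y (⟨-, hy⟩ | ⟨hy, hyx⟩)
      · exact Subtype.ext hy.symm
      · exact absurd (hyx ▸ (hfA y hy).1) (hBA x hx)
    · have hm : b ∈ s := (hms _).2 (Finset.mem_union_right _ hb)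
      refine ⟨⟨b, hm⟩, Or.inr ⟨hb, hbx⟩, ?_⟩
      rintro y (⟨hx, hy⟩ | ⟨hy, hyx⟩)
      · exact absurd (hbx ▸ (hfA b hb).1) (hBA x hx)
      · exact Subtype.ext (hf hy hb (hyx.trans hbx.symm))
  · have himg : B.image f ⊆ A := fun x hx => by
      obtain ⟨b, hb, rfl⟩ := Finset.mem_image.1 hx
      exact (hfA b hb).1
    have hc : (A \ B.image f).card ≤ 1 := by
      rw [Finset.card_sdiff_of_subset himg, Finset.card_image_of_injOn hf]
      omega
    have hmem : ∀ x : s, x ∈ M.vertsᶜ → (x : V) ∈ A \ B.image f := by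
      intro x hx
      have hxs : (x : V) ∈ A ∪ B := (hms _).1 x.2
      simp only [M, Set.mem_compl_iff, Set.mem_ofPred_eq, not_or] at hx
      rw [Finset.mem_sdiff, Finset.mem_image]
      exact ⟨(Finset.mem_union.1 hxs).resolve_right hx.1, hx.2⟩
    intro x hx y hy
    exact Subtype.ext (Finset.card_le_one.1 hc _ (hmem x hx) _ (hmem y hy))

/-- Hall's condition for a bipartition `A`, `B` follows from three properties: large enough
degrees between the parts, no small set sending many edges into a set that is not larger, and an
edge between any two linear-sized sets. A violating `W ⊆ B` is excluded by the second property if it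
is small; if it is large, then the third makes `A \ N(W)` small, and that set contradicts the
second property together with `B \ W`. -/
theorem exists_injOn_of_expansion {a r : ℝ}
    (hexp : ∀ W N : Finset V, Disjoint W N → W.Nonempty → N.card ≤ W.card → (W.card : ℝ) ≤ r →
      ∃ w ∈ W, (G.degreeIn w N : ℝ) ≤ a)
    (hjoin : ∀ X Y : Finset V, Disjoint X Y → r ≤ X.card → r ≤ Y.card →
      ∃ x ∈ X, ∃ y ∈ Y, G.Adj x y)
    {A B : Finset V} (hd : Disjoint A B) (hcard : B.card ≤ A.card)
    (hB : ∀ b ∈ B, a < G.degreeIn b A) (hA : ∀ x ∈ A, a < G.degreeIn x B) :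
    ∃ f : V → V, Set.InjOn f B ∧ ∀ b ∈ B, f b ∈ A ∧ G.Adj b (f b) := by
  classical
  have hall : ∀ W ⊆ B, W.card ≤ (A.filter fun x => ∃ w ∈ W, G.Adj w x).card := by
    intro W hWB
    by_contra! hlt
    set N := A.filter fun x => ∃ w ∈ W, G.Adj w x with hN
    have hNA : N ⊆ A := Finset.filter_subset _ _
    have hWne : W.Nonempty := Finset.card_pos.1 (by omega)
    have hWc := Finset.card_le_card hWB
    rcases le_or_gt (W.card : ℝ) r with hr | hr
    · obtain ⟨w, hw, hwa⟩ := hexp W N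
        (hd.symm.mono hWB hNA) hWne hlt.le hr
      have h1 : G.degreeIn w A ≤ G.degreeIn w N := by
        refine Finset.card_le_card fun x hx => ?_
        simp only [Finset.mem_filter, hN] at hx ⊢
        exact ⟨⟨hx.1, w, hw, hx.2⟩, hx.2⟩
      have h2 : (G.degreeIn w A : ℝ) ≤ G.degreeIn w N := by exact_mod_cast h1
      linarith [hB w (hWB hw)]
    · have hYcard : (A \ N).card = A.card - N.card := Finset.card_sdiff_of_subset hNA
      have hBWcard : (B \ W).card = B.card - W.card := Finset.card_sdiff_of_subset hWB
      have hNcard := Finset.card_le_card hNA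
      have hnadj : ∀ y ∈ A \ N, ∀ w ∈ W, ¬ G.Adj w y := by
        intro y hy w hw hwy
        simp only [hN, Finset.mem_sdiff, Finset.mem_filter] at hy
        exact hy.2 ⟨hy.1, w, hw, hwy⟩
      rcases le_or_gt (A \ N).card.cast r with hr' | hr'
      · obtain ⟨y, hy, hya⟩ := hexp (A \ N) (B \ W)
          (hd.mono Finset.sdiff_subset Finset.sdiff_subset)
          (Finset.card_pos.1 (by omega)) (by omega) hr'
        have h1 : G.degreeIn y B ≤ G.degreeIn y (B \ W) := by
          refine Finset.card_le_card fun x hx => ?_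
          simp only [Finset.mem_filter, Finset.mem_sdiff] at hx ⊢
          exact ⟨⟨hx.1, fun hw => hnadj y hy x hw hx.2.symm⟩, hx.2⟩
        have h2 : (G.degreeIn y B : ℝ) ≤ G.degreeIn y (B \ W) := by exact_mod_cast h1
        linarith [hA y (Finset.mem_sdiff.1 hy).1]
      · obtain ⟨w, hw, y, hy, hwy⟩ := hjoin W (A \ N)
          (hd.symm.mono hWB Finset.sdiff_subset) hr.le hr'.le
        exact hnadj y hy w hw hwy
  obtain ⟨g, hg, hgt⟩ := (Finset.all_card_le_biUnion_card_iff_exists_injective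
    (fun b : B => A.filter (G.Adj b))).1 (by
      intro W
      have := hall (W.map (Function.Embedding.subtype _)) (by
        intro x hx
        obtain ⟨b, -, rfl⟩ := Finset.mem_map.1 hx
        exact b.2)
      rw [Finset.card_map] at this
      refine this.trans (Finset.card_le_card fun x hx => ?_)
      simp only [Finset.mem_filter, Finset.mem_map, Finset.mem_biUnion] at hx ⊢
      obtain ⟨hxA, w, ⟨b, hb, rfl⟩, hadj⟩ := hx
      exact ⟨b, hb, hxA, hadj⟩)
  refine ⟨fun v => if h : v ∈ B then g ⟨v, h⟩ else v, ?_, ?_⟩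
  · intro x hx y hy hxy
    have hx' : x ∈ B := hx
    have hy' : y ∈ B := hy
    simp only [hx', hy', dif_pos] at hxy
    exact congrArg Subtype.val (hg hxy)
  · intro b hb
    simp only [hb, dif_pos]
    exact Finset.mem_filter.1 (hgt ⟨b, hb⟩)

theorem IsTriangleMatching.card_biUnion [DecidableEq V] {M : Finset (Finset V)}
    (hM : G.IsTriangleMatching M) : (M.biUnion id).card = 3 * M.card := by
  rw [Finset.card_biUnion (t := id) (fun T hT T' hT' h => hM.2 hT hT' h),
    Finset.sum_congr rfl (fun T hT => show (id T).card = 3 from (hM.1 T hT).2),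
    Finset.sum_const, smul_eq_mul, mul_comm]

end

/-- Every vertex outside a maximum triangle-matching keeps more than `a` neighbours in each of the
reserved sets `P₀`, `P₁`, so that any balanced bipartition of the remaining vertices that separates
the remnants of `P₀` and `P₁` satisfies Hall's condition. -/
theorem hasNearPerfectMatching_induce_of_expansion {V : Type*} [Fintype V] [DecidableEq V]
    {G : SimpleGraph V}
    {a r : ℝ} {P₀ P₁ : Finset V} (hP : Disjoint P₀ P₁) (hP₀ : 5 * P₀.card ≤ 2 * Fintype.card V)
    (hP₁ : 5 * P₁.card ≤ 2 * Fintype.card V)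
    (hdeg₀ : ∀ v, 2 * a < G.degreeIn v P₀) (hdeg₁ : ∀ v, 2 * a < G.degreeIn v P₁)
    (hstar : ∀ M, G.IsTriangleMatching M → ∀ v, (∀ T ∈ M, v ∉ T) →
      (G.degreeIn v (M.biUnion id) : ℝ) ≤ a)
    (htri : ∀ M, G.IsTriangleMatching M → 30 * M.card ≤ Fintype.card V)
    (hexp : ∀ W N : Finset V, Disjoint W N → W.Nonempty → N.card ≤ W.card → (W.card : ℝ) ≤ r →
      ∃ w ∈ W, (G.degreeIn w N : ℝ) ≤ a)
    (hjoin : ∀ X Y : Finset V, Disjoint X Y → r ≤ X.card → r ≤ Y.card →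
      ∃ x ∈ X, ∃ y ∈ Y, G.Adj x y)
    {S : Set V} (hS : G.IsMaximumTriangleMatchingVerts S) :
    (G.induce Sᶜ).HasNearPerfectMatching := by
  obtain ⟨M, ⟨hM, -⟩, rfl⟩ := hS
  set U := M.biUnion id with hU
  have hUcard : U.card = 3 * M.card := hM.card_biUnion
  have hMc := htri M hM
  have hmemU : ∀ v, v ∈ U ↔ ∃ T ∈ M, v ∈ T := fun v => by simp [hU]
  have hUc : Uᶜ.card = Fintype.card V - U.card := Finset.card_compl U
  have hUle : U.card ≤ Fintype.card V := Finset.card_le_univ U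
  have hs0 : (P₀ \ U).card ≤ P₀.card := Finset.card_le_card Finset.sdiff_subset
  have hs1 : (P₁ \ U).card ≤ P₁.card := Finset.card_le_card Finset.sdiff_subset
  have hsub1 : P₁ \ U ⊆ Uᶜ := fun x hx => by simp at hx ⊢; exact hx.2
  have hsub : P₀ \ U ⊆ Uᶜ \ (P₁ \ U) := by
    intro x hx
    simp only [Finset.mem_sdiff, Finset.mem_compl] at hx ⊢
    exact ⟨hx.2, fun h => Finset.disjoint_left.1 hP hx.1 h.1⟩
  have hc1 : (Uᶜ \ (P₁ \ U)).card = Uᶜ.card - (P₁ \ U).card := Finset.card_sdiff_of_subset hsub1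
  obtain ⟨A, hPA, hAU, hAcard⟩ := Finset.exists_subsuperset_card_eq (n := (Uᶜ.card + 1) / 2) hsub
    (by omega) (by omega)
  have hAU' : A ⊆ Uᶜ := hAU.trans Finset.sdiff_subset
  have hBcard : (Uᶜ \ A).card = Uᶜ.card - A.card := Finset.card_sdiff_of_subset hAU'
  have hPB : P₁ \ U ⊆ Uᶜ \ A := fun x hx => Finset.mem_sdiff.2
    ⟨hsub1 hx, fun hA => (Finset.mem_sdiff.1 (hAU hA)).2 hx⟩
  have key : ∀ v ∉ U, ∀ P Q : Finset V, 2 * a < G.degreeIn v P → P \ U ⊆ Q →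
      a < G.degreeIn v Q := by
    intro v hv P Q h hPQ
    have h1 := hstar M hM v (fun T hT hvT => hv ((hmemU v).2 ⟨T, hT, hvT⟩))
    have h2 := degreeIn_le_add_sdiff (G := G) v P U
    have h3 := degreeIn_mono (G := G) (v := v) hPQ
    have h4 : (G.degreeIn v P : ℝ) ≤ G.degreeIn v U + G.degreeIn v Q := by
      exact_mod_cast h2.trans (Nat.add_le_add_left h3 _)
    linarith
  have hdAB : Disjoint A (Uᶜ \ A) := Finset.disjoint_sdiff
  obtain ⟨f, hf, hfA⟩ := exists_injOn_of_expansion hexp hjoin hdAB (by omega)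
    (fun b hb => key b (Finset.mem_compl.1 (Finset.mem_sdiff.1 hb).1) P₀ A (hdeg₀ b) hPA)
    (fun x hx => key x (Finset.mem_compl.1 (hAU' hx)) P₁ _ (hdeg₁ x) hPB)
  refine hasNearPerfectMatching_induce_of_injOn ?_ hdAB (by omega) hf hfA
  ext v
  rw [Finset.union_sdiff_of_subset hAU']
  simp [hmemU]

end SimpleGraph

/-! ### The chromatic number of the complement -/

namespace SimpleGraph
variable {V : Type*} [Fintype V]

/-- The edges of a near-perfect matching of `H`, and possibly one single vertex, are the colour
classes of a colouring of `Hᶜ`. -/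
theorem HasNearPerfectMatching.colorable_compl {H : SimpleGraph V}
    (h : H.HasNearPerfectMatching) : Hᶜ.Colorable ((Fintype.card V + 1) / 2) := by
  classical
  obtain ⟨M, hM, hsub⟩ := h
  let c : V → Sym2 V := fun v => if hv : v ∈ M.verts then s(v, (hM hv).choose) else s(v, v)
  have hc : ∀ v w, M.Adj v w → c v = s(v, w) := by
    intro v w hvw
    have hv := M.edge_vert hvw
    simp only [c, hv, dif_pos]
    rw [(hM hv).choose_spec.2 w hvw]
  have hc' : ∀ v ∉ M.verts, c v = s(v, v) := fun v hv => by simp [c, hv]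
  have hex : ∀ v ∈ M.verts, ∃ w, M.Adj v w := fun v hv => (hM hv).exists
  let C : Hᶜ.Coloring (Finset.univ.image c) := Coloring.mk
    (fun v => ⟨c v, Finset.mem_image_of_mem _ (Finset.mem_univ _)⟩) (by
      intro v w hvw heq
      have heq : c v = c w := congrArg Subtype.val heq
      rw [compl_adj] at hvw
      by_cases hv : v ∈ M.verts
      · obtain ⟨x, hx⟩ := hex v hv
        by_cases hw : w ∈ M.verts
        · obtain ⟨y, hy⟩ := hex w hw
          rw [hc v x hx, hc w y hy, Sym2.eq_iff] at heq
          rcases heq with ⟨h1, -⟩ | ⟨h1, h2⟩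
          · exact hvw.1 h1
          · exact hvw.2 (h2 ▸ hx.adj_sub)
        · rw [hc v x hx, hc' w hw, Sym2.eq_iff] at heq
          exact hvw.1 (by tauto)
      · by_cases hw : w ∈ M.verts
        · obtain ⟨y, hy⟩ := hex w hw
          rw [hc' v hv, hc w y hy, Sym2.eq_iff] at heq
          exact hvw.1 (by tauto)
        · rw [hc' v hv, hc' w hw, Sym2.eq_iff] at heq
          exact hvw.1 (by tauto))
  refine C.colorable.mono ?_
  rw [Fintype.card_coe]
  set X := Finset.univ.filter (· ∈ M.verts)
  set Y := Finset.univ.filter (· ∉ M.verts)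
  have hXY : X.card + Y.card = Fintype.card V := Finset.card_filter_add_card_filter_not _
  have hY : Y.card ≤ 1 := Finset.card_le_one.2 fun x hx y hy =>
    hsub (by simpa [Y] using hx) (by simpa [Y] using hy)
  have hX : 2 * (X.image c).card ≤ X.card := by
    refine Finset.mul_card_image_le_card X 2 fun b hb => ?_
    obtain ⟨v, hv, rfl⟩ := Finset.mem_image.1 hb
    obtain ⟨w, hw⟩ := hex v (by simpa [X] using hv)
    have hle : ({v, w} : Finset V) ⊆ X.filter (fun x => c x = c v) := by
      intro x hx
      rw [Finset.mem_insert, Finset.mem_singleton] at hx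
      rcases hx with rfl | rfl
      · simp [hv]
      · simp only [X, Finset.mem_filter, Finset.mem_univ, true_and]
        exact ⟨M.edge_vert hw.symm, by rw [hc _ _ hw, hc _ _ hw.symm, Sym2.eq_swap]⟩
    rw [← Finset.card_pair hw.ne]
    exact Finset.card_le_card hle
  have hun : (Finset.univ.image c) = X.image c ∪ Y.image c := by
    rw [← Finset.image_union, Finset.filter_union_filter_not_eq]
  have h1 := Finset.card_union_le (X.image c) (Y.image c)
  have h2 := Finset.card_image_le (s := Y) (f := c)
  rw [hun]
  omega

theorem IsTriangleMatching.card_le_triangleMatchingNumber {G : SimpleGraph V}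
    {M : Finset (Finset V)} (hM : G.IsTriangleMatching M) :
    M.card ≤ G.triangleMatchingNumber := by
  classical
  exact Finset.le_sup (f := Finset.card) (by simpa using hM)

theorem IsMaximumTriangleMatching.card_eq {G : SimpleGraph V} {M : Finset (Finset V)}
    (hM : G.IsMaximumTriangleMatching M) : M.card = G.triangleMatchingNumber := by
  classical
  refine le_antisymm hM.1.card_le_triangleMatchingNumber (Finset.sup_le fun M' hM' => hM.2 M' ?_)
  simpa using hM'

/-- Colour classes of `Gᶜ` are cliques of `G`; without `K₄` they have at most three vertices, and
those with three form a triangle-matching. -/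
theorem card_le_of_colorable_compl {G : SimpleGraph V} (hG : G.CliqueFree 4) {k : ℕ}
    (hk : Gᶜ.Colorable k) : Fintype.card V ≤ 2 * k + G.triangleMatchingNumber := by
  classical
  obtain ⟨C⟩ := hk
  let F : Fin k → Finset V := fun i => Finset.univ.filter (fun v => C v = i)
  have hmem : ∀ i v, v ∈ F i ↔ C v = i := fun i v => by simp [F]
  have hclique : ∀ i, G.IsClique (F i) := by
    intro i v hv w hw hne
    by_contra hnadj
    have hv := (hmem i v).1 hv
    have hw := (hmem i w).1 hw
    exact C.valid (show Gᶜ.Adj v w from ⟨hne, hnadj⟩) (hv.trans hw.symm)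
  have hle : ∀ i, (F i).card ≤ 3 := by
    intro i
    by_contra! h
    obtain ⟨T, hT, hTc⟩ := Finset.exists_subset_card_eq (show 4 ≤ (F i).card by omega)
    exact hG T ⟨(hclique i).subset hT, hTc⟩
  set J := Finset.univ.filter (fun i => (F i).card = 3) with hJ
  have hdisj : ∀ i j, i ≠ j → Disjoint (F i) (F j) := by
    intro i j hij
    refine Finset.disjoint_left.2 fun v hv hv' => hij ?_
    rw [← (hmem i v).1 hv, (hmem j v).1 hv']
  have hinj : Set.InjOn F J := by
    intro i hi j hj hij
    by_contra hne
    have := hdisj i j hne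
    rw [← hij, Finset.disjoint_self_iff_empty] at this
    simp [hJ, this] at hi
  have hM : G.IsTriangleMatching (J.image F) := by
    refine ⟨?_, ?_⟩
    · intro T hT
      obtain ⟨i, hi, rfl⟩ := Finset.mem_image.1 hT
      exact ⟨hclique i, by simpa [hJ] using hi⟩
    · intro T hT T' hT' hne
      obtain ⟨i, hi, rfl⟩ := Finset.mem_image.1 (Finset.mem_coe.1 hT)
      obtain ⟨j, hj, rfl⟩ := Finset.mem_image.1 (Finset.mem_coe.1 hT')
      exact hdisj i j (fun h => hne (h ▸ rfl))
  have hJs := hM.card_le_triangleMatchingNumber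
  rw [Finset.card_image_of_injOn hinj] at hJs
  calc Fintype.card V = ∑ i, (F i).card :=
        Finset.card_eq_sum_card_fiberwise (s := Finset.univ) (f := C) (t := Finset.univ) (by simp)
    _ ≤ ∑ i : Fin k, (2 + if (F i).card = 3 then 1 else 0) := by
        refine Finset.sum_le_sum fun i _ => ?_
        have := hle i
        split_ifs <;> omega
    _ = 2 * k + J.card := by
        rw [Finset.sum_add_distrib, Finset.sum_const, Finset.sum_boole]
        simp [hJ, mul_comm]
    _ ≤ _ := by omega

theorem chromaticNumber_compl_eq {G : SimpleGraph V} (hG : G.CliqueFree 4) {S : Set V}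
    (hS : G.IsMaximumTriangleMatchingVerts S) (h : (G.induce Sᶜ).HasNearPerfectMatching) :
    Gᶜ.chromaticNumber =
      ((⌈((Fintype.card V : ℝ) - (G.triangleMatchingNumber : ℝ)) / 2⌉₊ : ℕ) : ℕ∞) := by
  classical
  refine le_antisymm (Colorable.chromaticNumber_le ?_) ?_
  · obtain ⟨M, hM, hSM⟩ := hS
    obtain ⟨C⟩ := h.colorable_compl
    set W := Fintype.card (Sᶜ : Set V)
    have hT : ∀ v, v ∈ S → ∃ T ∈ M, v ∈ T := fun v hv => by rw [hSM] at hv; exact hv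
    let c : V → M ⊕ Fin ((W + 1) / 2) := fun v =>
      if hv : v ∈ S then Sum.inl ⟨(hT v hv).choose, (hT v hv).choose_spec.1⟩
      else Sum.inr (C ⟨v, hv⟩)
    have C' : Gᶜ.Coloring (M ⊕ Fin ((W + 1) / 2)) := Coloring.mk c (by
      intro v w hvw heq
      rw [compl_adj] at hvw
      by_cases hv : v ∈ S <;> by_cases hw : w ∈ S
      · simp only [c, hv, hw, dif_pos, Sum.inl.injEq, Subtype.mk.injEq] at heq
        have h1 := (hT v hv).choose_spec
        have h2 := (hT w hw).choose_spec.2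
        rw [← heq] at h2
        exact hvw.2 ((hM.1.1 _ h1.1).1 h1.2 h2 hvw.1)
      · simp [c, hv, hw] at heq
      · simp [c, hv, hw] at heq
      · simp only [c, hv, hw, dif_neg, Sum.inr.injEq, not_false_eq_true] at heq
        refine C.valid ?_ heq
        rw [compl_adj]
        exact ⟨fun h => hvw.1 (congrArg Subtype.val h), fun h => hvw.2 h⟩)
    refine C'.colorable.mono ?_
    have hcS : M.biUnion id = S.toFinset := by ext v; simp [hSM]
    have h3 := hM.1.card_biUnion
    have hW : W = Fintype.card V - 3 * M.card := by
      rw [← h3, hcS, ← Finset.card_compl, ← Set.toFinset_compl, Set.toFinset_card]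
    have hle : 3 * M.card ≤ Fintype.card V := h3 ▸ Finset.card_le_univ _
    rw [Fintype.card_sum, Fintype.card_coe, Fintype.card_fin, hM.card_eq] at *
    have h4 := Nat.le_ceil (((Fintype.card V : ℝ) - (G.triangleMatchingNumber : ℝ)) / 2)
    set k := ⌈((Fintype.card V : ℝ) - (G.triangleMatchingNumber : ℝ)) / 2⌉₊
    have h5 : (Fintype.card V : ℝ) ≤ 2 * k + G.triangleMatchingNumber := by linarith
    have h6 : Fintype.card V ≤ 2 * k + G.triangleMatchingNumber := by exact_mod_cast h5
    omega
  · rw [le_chromaticNumber_iff_colorable]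
    intro m hm
    have h1 := card_le_of_colorable_compl hG hm
    have h2 : (Fintype.card V : ℝ) ≤ 2 * m + G.triangleMatchingNumber := by exact_mod_cast h1
    exact Nat.ceil_le.2 (by linarith)

end SimpleGraph

/-! ### Probabilities of the exceptional events -/

namespace SimpleGraph
open MeasureTheory ProbabilityTheory unitInterval

section Pairs
variable {V : Type*}

open Classical in
/-- The unordered pairs with one element in `W` and one in `N`. -/
noncomputable def pairsBetween (W N : Finset V) : Finset (Sym2 V) :=
  (W ×ˢ N).image fun x => s(x.1, x.2)

open Classical in
/-- The unordered pairs of distinct elements of `T`. -/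
noncomputable def pairsIn (T : Finset V) : Finset (Sym2 V) :=
  T.offDiag.image Sym2.mk.uncurry

theorem mem_pairsIn {T : Finset V} {x y : V} : s(x, y) ∈ pairsIn T ↔ x ∈ T ∧ y ∈ T ∧ x ≠ y := by
  classical
  simp only [pairsIn, Finset.mem_image, Finset.mem_offDiag, Prod.exists,
    Function.uncurry_apply_pair,
    Sym2.eq_iff]
  constructor
  · rintro ⟨a, b, ⟨ha, hb, hab⟩, ⟨rfl, rfl⟩ | ⟨rfl, rfl⟩⟩
    · exact ⟨ha, hb, hab⟩
    · exact ⟨hb, ha, hab.symm⟩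
  · rintro ⟨hx, hy, hxy⟩
    exact ⟨x, y, ⟨hx, hy, hxy⟩, Or.inl ⟨rfl, rfl⟩⟩

theorem card_pairsIn (T : Finset V) : (pairsIn T).card = T.card.choose 2 := by
  classical
  exact Sym2.card_image_offDiag T

theorem not_isDiag_of_mem_pairsIn {T : Finset V} {e : Sym2 V} (he : e ∈ pairsIn T) :
    ¬ e.IsDiag := by
  induction e with
  | _ x y => exact fun h => (mem_pairsIn.1 he).2.2 (Sym2.mk_isDiag_iff.1 h)

theorem IsClique.mem_edgeSet_of_mem_pairsIn {G : SimpleGraph V} {T : Finset V}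
    (hT : G.IsClique (T : Set V)) {e : Sym2 V} (he : e ∈ pairsIn T) : e ∈ G.edgeSet := by
  induction e with
  | _ x y =>
    obtain ⟨hx, hy, hxy⟩ := mem_pairsIn.1 he
    exact hT hx hy hxy

theorem not_isDiag_of_mem_pairsBetween {W N : Finset V} (h : Disjoint W N) {e : Sym2 V}
    (he : e ∈ pairsBetween W N) : ¬ e.IsDiag := by
  classical
  simp only [pairsBetween, Finset.mem_image, Finset.mem_product, Prod.exists] at he
  obtain ⟨x, y, ⟨hx, hy⟩, rfl⟩ := he
  rw [Sym2.mk_isDiag_iff]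
  rintro rfl
  exact Finset.disjoint_left.1 h hx hy

theorem injOn_pairsBetween {W N : Finset V} (h : Disjoint W N) :
    Set.InjOn (fun x : V × V => s(x.1, x.2)) (W ×ˢ N : Finset (V × V)) := by
  rintro ⟨x, y⟩ hx ⟨x', y'⟩ hx' heq
  rw [Finset.mem_coe, Finset.mem_product] at hx hx'
  rcases Sym2.eq_iff.1 heq with ⟨h1, h2⟩ | ⟨h1, h2⟩
  · exact Prod.ext h1 h2
  · exact absurd (h1 ▸ hx.1) (fun hW => Finset.disjoint_left.1 h hW hx'.2)

theorem card_pairsBetween {W N : Finset V} (h : Disjoint W N) :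
    (pairsBetween W N).card = W.card * N.card := by
  classical
  rw [pairsBetween, Finset.card_image_of_injOn (injOn_pairsBetween h), Finset.card_product]

theorem edgeCountIn_pairsBetween (G : SimpleGraph V) {W N : Finset V} (h : Disjoint W N) :
    G.edgeCountIn (pairsBetween W N) = ∑ w ∈ W, G.degreeIn w N := by
  classical
  rw [edgeCountIn, pairsBetween, Finset.filter_image, Finset.card_image_of_injOn
    ((injOn_pairsBetween h).mono (Finset.coe_subset.2 (Finset.filter_subset _ _))),
    Finset.card_filter, Finset.sum_product]
  refine Finset.sum_congr rfl fun w _ => ?_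
  rw [degreeIn, Finset.card_filter]
  exact Finset.sum_congr rfl fun x _ => by simp only [mem_edgeSet]

end Pairs

variable {V : Type*} [Fintype V]

theorem binomialRandom_real_exists_degreeIn_le (p : I) (P : Finset V) (c : ℝ) :
    (binomialRandom V p).real {G | ∃ v, (G.degreeIn v P : ℝ) ≤ c} ≤
      Fintype.card V * Real.exp (c - 63 / 100 * (p * (P.card - 1 : ℝ))) := by
  classical
  have hp0 : (0 : ℝ) ≤ p := p.2.1
  rw [Set.ofPred_exists]
  refine (measureReal_iUnion_fintype_le _).trans ?_
  refine (Finset.sum_le_card_nsmul _ _ _ fun v _ => ?_).trans_eq (nsmul_eq_mul _ _)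
  -- `v` may belong to `P`, and the pair formed by `v` twice has to be left out
  have hd : Disjoint {v} (P.erase v) := by simp
  have h := binomialRandom_real_edgeCountIn_le_le_exp p
    (fun e he => not_isDiag_of_mem_pairsBetween hd he) c
  simp only [edgeCountIn_pairsBetween _ hd, Finset.sum_singleton, card_pairsBetween hd,
    Finset.card_singleton, one_mul] at h
  have hset : ∀ G : SimpleGraph V, G.degreeIn v (P.erase v) = G.degreeIn v P := by
    intro G
    refine congrArg Finset.card ?_
    ext x
    simp only [Finset.mem_filter, Finset.mem_erase]
    exact ⟨fun h => ⟨h.1.2, h.2⟩, fun h => ⟨⟨h.2.ne', h.1⟩, h.2⟩⟩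
  simp only [hset] at h
  refine h.trans (Real.exp_le_exp.2 ?_)
  have h1 : (P.card : ℝ) ≤ (P.erase v).card + 1 := by
    exact_mod_cast (by have := Finset.pred_card_le_card_erase (a := v) (s := P); omega :
      P.card ≤ (P.erase v).card + 1)
  have h2 : (p : ℝ) * (P.card - 1 : ℝ) ≤ p * (P.erase v).card :=
    mul_le_mul_of_nonneg_left (by linarith) hp0
  linarith

theorem binomialRandom_real_exists_forall_not_adj_le (p : I) {r : ℝ} (hr : 0 ≤ r) :
    (binomialRandom V p).real {G | ∃ X Y : Finset V, Disjoint X Y ∧ r ≤ X.card ∧ r ≤ Y.card ∧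
      ∀ x ∈ X, ∀ y ∈ Y, ¬ G.Adj x y} ≤
      4 ^ Fintype.card V * Real.exp (-(63 / 100 * (p * r ^ 2))) := by
  classical
  have hp0 : (0 : ℝ) ≤ p := p.2.1
  have hsub : {G : SimpleGraph V | ∃ X Y : Finset V, Disjoint X Y ∧ r ≤ X.card ∧ r ≤ Y.card ∧
      ∀ x ∈ X, ∀ y ∈ Y, ¬ G.Adj x y} ⊆ ⋃ Z : Finset V × Finset V,
      {G | (Disjoint Z.1 Z.2 ∧ r ≤ Z.1.card ∧ r ≤ Z.2.card) ∧
        ∀ x ∈ Z.1, ∀ y ∈ Z.2, ¬ G.Adj x y} := by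
    rintro G ⟨X, Y, h1, h2, h3, h4⟩
    exact Set.mem_iUnion.2 ⟨(X, Y), ⟨h1, h2, h3⟩, h4⟩
  refine (measureReal_mono hsub (measure_ne_top _ _)).trans
    ((measureReal_iUnion_fintype_le _).trans ?_)
  have hcard : (4 : ℝ) ^ Fintype.card V =
      ((Finset.univ : Finset (Finset V × Finset V)).card : ℝ) := by
    rw [Finset.card_univ, Fintype.card_prod, Fintype.card_finset]
    push_cast
    rw [← mul_pow]; norm_num
  rw [hcard]
  refine (Finset.sum_le_card_nsmul _ _ _ fun Z _ => ?_).trans_eq (nsmul_eq_mul _ _)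
  obtain ⟨X, Y⟩ := Z
  by_cases hZ : Disjoint X Y ∧ r ≤ X.card ∧ r ≤ Y.card
  · obtain ⟨hd, hX, hY⟩ := hZ
    have h := binomialRandom_real_edgeCountIn_le_le_exp p
      (fun e he => not_isDiag_of_mem_pairsBetween hd he) 0
    refine (measureReal_mono ?_ (measure_ne_top _ _)).trans (h.trans (Real.exp_le_exp.2 ?_))
    · rintro G ⟨-, hG⟩
      have : G.edgeCountIn (pairsBetween X Y) = 0 := by
        rw [edgeCountIn_pairsBetween G hd]
        refine Finset.sum_eq_zero fun x hx => ?_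
        simp only [degreeIn, Finset.card_eq_zero, Finset.filter_eq_empty_iff]
        exact fun y hy => hG x hx y hy
      simp [this]
    · rw [card_pairsBetween hd, zero_sub, neg_le_neg_iff]
      push_cast
      have : r ^ 2 ≤ (X.card : ℝ) * Y.card := by rw [sq]; gcongr
      gcongr
  · have : {G : SimpleGraph V | (Disjoint X Y ∧ r ≤ X.card ∧ r ≤ Y.card) ∧
        ∀ x ∈ X, ∀ y ∈ Y, ¬ G.Adj x y} = ∅ := by
      ext G; simp only [hZ, false_and]; rfl
    simp only [this, measureReal_empty]
    positivity

/-- Small sets `W` do not send many edges into a set that is not larger. The union bound runs over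
the at most `|V| ^ (2 * w)` pairs of disjoint sets of the same size `w`. -/
theorem binomialRandom_real_exists_dense_pair_le (p : I) {a r : ℝ}
    (hr : 2 * r ≤ Fintype.card V) :
    (binomialRandom V p).real {G | ∃ W N : Finset V, Disjoint W N ∧ W.Nonempty ∧
      N.card ≤ W.card ∧ (W.card : ℝ) ≤ r ∧ ∀ w ∈ W, a < G.degreeIn w N} ≤
      ∑ w ∈ Finset.Icc 1 (Fintype.card V),
        ((Fintype.card V : ℝ) ^ 2 * Real.exp (-a + 2 * (p * r))) ^ w := by
  classical
  have hp0 : (0 : ℝ) ≤ p := p.2.1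
  set n := Fintype.card V with hn
  have hsub : {G : SimpleGraph V | ∃ W N : Finset V, Disjoint W N ∧ W.Nonempty ∧
      N.card ≤ W.card ∧ (W.card : ℝ) ≤ r ∧ ∀ w ∈ W, a < G.degreeIn w N} ⊆
      ⋃ w ∈ Finset.Icc 1 n, ⋃ Z ∈ Finset.univ.powersetCard w ×ˢ Finset.univ.powersetCard w,
        {G | (Disjoint Z.1 Z.2 ∧ (w : ℝ) ≤ r) ∧ ∀ x ∈ Z.1, a < G.degreeIn x Z.2} := by
    rintro G ⟨W, N, hd, hne, hc, hWr, hdeg⟩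
    have h1 : 2 * (W.card : ℝ) ≤ n := by linarith
    have h2 : 2 * W.card ≤ n := by exact_mod_cast h1
    -- enlarging `N` to the size of `W` only increases the degrees
    have h3 : Wᶜ.card = n - W.card := Finset.card_compl W
    obtain ⟨N', hNN', hN'W, hN'c⟩ := Finset.exists_subsuperset_card_eq (s := N) (t := Wᶜ)
      (n := W.card) (fun x hx => Finset.mem_compl.2 fun hW => Finset.disjoint_left.1 hd hW hx)
      hc (by omega)
    have hd' : Disjoint W N' := Finset.disjoint_left.2 fun x hx hx' =>
      Finset.mem_compl.1 (hN'W hx') hx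
    simp only [Set.mem_iUnion]
    refine ⟨W.card, Finset.mem_Icc.2 ⟨hne.card_pos, by omega⟩, (W, N'), ?_, ⟨hd', hWr⟩, ?_⟩
    · simp [hN'c]
    · intro x hx
      refine (hdeg x hx).trans_le ?_
      exact_mod_cast degreeIn_mono hNN'
  refine (measureReal_mono hsub (measure_ne_top _ _)).trans
    ((measureReal_biUnion_finset_le _ _).trans (Finset.sum_le_sum fun w hw => ?_))
  have hw1 : 1 ≤ w := (Finset.mem_Icc.1 hw).1
  refine (measureReal_biUnion_finset_le _ _).trans ?_
  have hterm : ∀ Z ∈ (Finset.univ : Finset V).powersetCard w ×ˢ Finset.univ.powersetCard w,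
      (binomialRandom V p).real
        {G | (Disjoint Z.1 Z.2 ∧ (w : ℝ) ≤ r) ∧ ∀ x ∈ Z.1, a < G.degreeIn x Z.2} ≤
      Real.exp (-a + 2 * (p * r)) ^ w := by
    rintro ⟨X, Y⟩ hZ
    simp only [Finset.mem_product, Finset.mem_powersetCard, Finset.subset_univ, true_and] at hZ
    by_cases hd : Disjoint X Y ∧ (w : ℝ) ≤ r
    · have h := binomialRandom_real_edgeCountIn_ge_le_exp p
        (fun e he => not_isDiag_of_mem_pairsBetween hd.1 he) (w * a)
      refine (measureReal_mono ?_ (measure_ne_top _ _)).trans (h.trans ?_)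
      · rintro G ⟨-, hG⟩
        simp only [Set.mem_ofPred_eq, edgeCountIn_pairsBetween G hd.1]
        push_cast
        rw [← hZ.1, ← nsmul_eq_mul]
        exact Finset.card_nsmul_le_sum _ _ _ fun x hx => (hG x hx).le
      · rw [card_pairsBetween hd.1, hZ.1, hZ.2, ← Real.exp_nat_mul]
        refine Real.exp_le_exp.2 ?_
        push_cast
        have : (p : ℝ) * (w * w) ≤ w * (p * r) := by
          have := mul_le_mul_of_nonneg_left hd.2 (mul_nonneg hp0 (Nat.cast_nonneg w))
          linarith
        linarith
    · have : {G : SimpleGraph V | (Disjoint X Y ∧ (w : ℝ) ≤ r) ∧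
          ∀ x ∈ X, a < G.degreeIn x Y} = ∅ := by
        ext G; simp only [hd, false_and]; rfl
      simp only [this, measureReal_empty]
      positivity
  refine (Finset.sum_le_card_nsmul _ _ _ hterm).trans ?_
  rw [nsmul_eq_mul, mul_pow, Finset.card_product, Finset.card_powersetCard, Finset.card_univ,
    ← hn, ← pow_mul, mul_comm 2 w, pow_mul, sq]
  gcongr
  push_cast
  have : ((n.choose w : ℕ) : ℝ) ≤ (n : ℝ) ^ w := by exact_mod_cast Nat.choose_le_pow n w
  gcongr

theorem binomialRandom_real_not_cliqueFree_four_le (p : I) :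
    (binomialRandom V p).real {G | ¬ G.CliqueFree 4} ≤
      Real.exp 1 * ((Fintype.card V : ℝ) ^ 4 * (p : ℝ) ^ 6) := by
  classical
  have h := binomialRandom_real_exists_disjoint_le p ((Finset.univ : Finset V).powersetCard 4)
    pairsIn 6 1 one_pos (fun T _ e he => not_isDiag_of_mem_pairsIn he) (fun T hT => by
      rw [card_pairsIn, (Finset.mem_powersetCard.1 hT).2]; rfl)
  refine (measureReal_mono ?_ (measure_ne_top _ _)).trans (h.trans ?_)
  · intro G hG
    simp only [CliqueFree, Set.mem_ofPred_eq, not_forall, not_not] at hG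
    obtain ⟨T, hT⟩ := hG
    refine ⟨{T}, by simp [hT.2], by simp, by simp, ?_⟩
    intro T' hT' e he
    rw [Finset.mem_singleton.1 hT'] at he
    exact hT.1.mem_edgeSet_of_mem_pairsIn he
  · rw [Nat.cast_one, div_one, pow_one, Finset.card_powersetCard, Finset.card_univ]
    have hp0 : (0 : ℝ) ≤ p := p.2.1
    gcongr
    exact_mod_cast Nat.choose_le_pow _ _

theorem binomialRandom_real_exists_isTriangleMatching_le (p : I) {m : ℕ} (hm : 0 < m) :
    (binomialRandom V p).real {G | ∃ M, G.IsTriangleMatching M ∧ m ≤ M.card} ≤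
      (Real.exp 1 * ((Fintype.card V : ℝ) ^ 3 * (p : ℝ) ^ 3) / m) ^ m := by
  classical
  have hp0 : (0 : ℝ) ≤ p := p.2.1
  have h := binomialRandom_real_exists_disjoint_le p ((Finset.univ : Finset V).powersetCard 3)
    pairsIn 3 m hm (fun T _ e he => not_isDiag_of_mem_pairsIn he) (fun T hT => by
      rw [card_pairsIn, (Finset.mem_powersetCard.1 hT).2]; rfl)
  refine (measureReal_mono ?_ (measure_ne_top _ _)).trans (h.trans ?_)
  · rintro G ⟨M, hM, hmM⟩
    obtain ⟨K, hKM, hK⟩ := Finset.exists_subset_card_eq hmM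
    refine ⟨K, fun T hT => by simp [(hM.1 T (hKM hT)).2], hK, ?_, ?_⟩
    · intro T hT T' hT' hne
      refine Finset.disjoint_left.2 fun e he he' => ?_
      induction e with
      | _ x y =>
        exact Finset.disjoint_left.1 (hM.2 (hKM hT) (hKM hT') hne)
          (mem_pairsIn.1 he).1 (mem_pairsIn.1 he').1
    · exact fun T hT e he => (hM.1 T (hKM hT)).1.mem_edgeSet_of_mem_pairsIn he
  · rw [Finset.card_powersetCard, Finset.card_univ]
    gcongr
    exact_mod_cast Nat.choose_le_pow _ _

/-- If `v` lies outside a triangle-matching that covers many neighbours of `v`, then there are many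
disjoint triangles joined to `v` by an edge; each of these configurations has four edges. -/
theorem binomialRandom_real_exists_degreeIn_isTriangleMatching_le [DecidableEq V] (p : I)
    {a : ℝ} {m : ℕ}
    (hm : 0 < m) (hma : ∀ k : ℕ, a < 3 * k → m ≤ k) :
    (binomialRandom V p).real {G | ∃ v M, G.IsTriangleMatching M ∧ (∀ T ∈ M, v ∉ T) ∧
      a < G.degreeIn v (M.biUnion id)} ≤
      Fintype.card V *
        (Real.exp 1 * (3 * (Fintype.card V : ℝ) ^ 3 * (p : ℝ) ^ 4) / m) ^ m := by
  classical
  have hp0 : (0 : ℝ) ≤ p := p.2.1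
  rw [Set.ofPred_exists]
  refine (measureReal_iUnion_fintype_le _).trans ?_
  refine (Finset.sum_le_card_nsmul _ _ _ fun v _ => ?_).trans_eq (nsmul_eq_mul _ _)
  let J : Finset ((_ : Finset V) × V) :=
    (((Finset.univ : Finset V).powersetCard 3).filter (v ∉ ·)).sigma fun T => T
  let F : ((_ : Finset V) × V) → Finset (Sym2 V) := fun i => insert s(v, i.2) (pairsIn i.1)
  have hJ : ∀ i, i ∈ J ↔ i.1.card = 3 ∧ v ∉ i.1 ∧ i.2 ∈ i.1 := by
    intro i; simp [J, and_assoc]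
  have h := binomialRandom_real_exists_disjoint_le p J F 4 m hm (by
      intro i hi e he
      have hi := (hJ i).1 hi
      rcases Finset.mem_insert.1 he with rfl | he
      · rw [Sym2.mk_isDiag_iff]
        exact fun h => hi.2.1 (h ▸ hi.2.2)
      · exact not_isDiag_of_mem_pairsIn he) (by
      intro i hi
      have hi := (hJ i).1 hi
      rw [Finset.card_insert_of_notMem (fun h => hi.2.1 (mem_pairsIn.1 h).1), card_pairsIn, hi.1]
      rfl)
  refine (measureReal_mono ?_ (measure_ne_top _ _)).trans (h.trans ?_)
  · rintro G ⟨M, hM, hv, hdeg⟩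
    set M' := M.filter (fun T => ∃ x ∈ T, G.Adj v x) with hM'
    have hM't : G.IsTriangleMatching M' := ⟨fun T hT => hM.1 T (Finset.mem_filter.1 hT).1,
      hM.2.mono (Finset.coe_subset.2 (Finset.filter_subset _ _))⟩
    have hle : G.degreeIn v (M.biUnion id) ≤ 3 * M'.card := by
      rw [← hM't.card_biUnion]
      refine Finset.card_le_card fun x hx => ?_
      simp only [Finset.mem_filter, Finset.mem_biUnion, id] at hx
      obtain ⟨⟨T, hT, hxT⟩, hadj⟩ := hx
      exact Finset.mem_biUnion.2 ⟨T, Finset.mem_filter.2 ⟨hT, x, hxT, hadj⟩, hxT⟩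
    have hle' : a < 3 * (M'.card : ℝ) := hdeg.trans_le (by exact_mod_cast hle)
    obtain ⟨L, hLM, hL⟩ := Finset.exists_subset_card_eq (hma _ hle')
    have : Nonempty V := ⟨v⟩
    have hex : ∀ T ∈ L, ∃ x ∈ T, G.Adj v x := fun T hT => (Finset.mem_filter.1 (hLM hT)).2
    choose! x hxT hadj using hex
    have hLM' : ∀ T ∈ L, T ∈ M := fun T hT => (Finset.mem_filter.1 (hLM hT)).1
    let t : Finset V → (_ : Finset V) × V := fun T => ⟨T, x T⟩
    have ht : Function.Injective t := fun T T' h => congrArg Sigma.fst h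
    refine ⟨L.image t, ?_, by rw [Finset.card_image_of_injective _ ht, hL], ?_, ?_⟩
    · intro i hi
      obtain ⟨T, hT, rfl⟩ := Finset.mem_image.1 hi
      exact (hJ _).2 ⟨(hM.1 T (hLM' T hT)).2, hv T (hLM' T hT), hxT T hT⟩
    · intro i hi j hj hne
      obtain ⟨T, hT, rfl⟩ := Finset.mem_image.1 (Finset.mem_coe.1 hi)
      obtain ⟨T', hT', rfl⟩ := Finset.mem_image.1 (Finset.mem_coe.1 hj)
      have hd := Finset.disjoint_left.1
        (hM.2 (hLM' T hT) (hLM' T' hT') (fun h => hne (h ▸ rfl)))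
      refine Finset.disjoint_left.2 fun e he he' => ?_
      rcases Finset.mem_insert.1 he with rfl | he
      · rcases Finset.mem_insert.1 he' with h' | he'
        · rw [Sym2.congr_right] at h'
          exact hd (hxT T hT) (by change x T = x T' at h'; rw [h']; exact hxT T' hT')
        · exact hv T' (hLM' T' hT') (mem_pairsIn.1 he').1
      · rcases Finset.mem_insert.1 he' with rfl | he'
        · exact hv T (hLM' T hT) (mem_pairsIn.1 he).1
        · induction e with
          | _ y z => exact hd (mem_pairsIn.1 he).1 (mem_pairsIn.1 he').1
    · intro i hi e he
      obtain ⟨T, hT, rfl⟩ := Finset.mem_image.1 hi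
      rcases Finset.mem_insert.1 he with rfl | he
      · exact hadj T hT
      · exact (hM.1 T (hLM' T hT)).1.mem_edgeSet_of_mem_pairsIn he
  · have hJc : J.card ≤ 3 * Fintype.card V ^ 3 := by
      rw [Finset.card_sigma]
      refine (Finset.sum_le_card_nsmul _ _ 3 fun T hT => ?_).trans ?_
      · simp only [Finset.mem_filter, Finset.mem_powersetCard] at hT
        exact hT.1.2.le
      · rw [smul_eq_mul, mul_comm]
        refine Nat.mul_le_mul_left _ ((Finset.card_filter_le _ _).trans ?_)
        rw [Finset.card_powersetCard, Finset.card_univ]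
        exact Nat.choose_le_pow _ _
    have hJc' : (J.card : ℝ) ≤ 3 * (Fintype.card V : ℝ) ^ 3 := by exact_mod_cast hJc
    gcongr

end SimpleGraph

/-! ### The threshold window -/

namespace SimpleGraph
open MeasureTheory ProbabilityTheory unitInterval

/-- The property that holds with high probability: no `K₄`, and removing any maximum
triangle-matching leaves a graph with a near-perfect matching. -/
def IsGoodForColoring {V : Type*} (G : SimpleGraph V) : Prop :=
  G.CliqueFree 4 ∧ ∀ S : Set V, G.IsMaximumTriangleMatchingVerts S →
    (G.induce Sᶜ).HasNearPerfectMatching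

section Estimates
variable {n : ℕ} {p : ℝ}

theorem exp_neg_le_inv_pow_four (hn : 0 < n) (hlow : 24576 * Real.log n ≤ n * p) {c : ℝ}
    (hc : n * p / 48 ≤ c) : Real.exp (-c) ≤ 1 / (n : ℝ) ^ 4 := by
  have hn' : (0 : ℝ) < n := by exact_mod_cast hn
  have hlog : 0 ≤ Real.log n := Real.log_natCast_nonneg n
  have h : (n : ℝ) ^ 4 = Real.exp (4 * Real.log n) := by
    rw [← Real.exp_log hn', ← Real.exp_nat_mul, Real.exp_log hn']
    norm_num
  rw [h, one_div, ← Real.exp_neg]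
  exact Real.exp_le_exp.2 (by linarith)

theorem mul_exp_neg_le_inv (hn : 1 ≤ n) (hlow : 24576 * Real.log n ≤ n * p) {c : ℝ}
    (hc : n * p / 48 ≤ c) : n * Real.exp (-c) ≤ 1 / (n : ℝ) := by
  have hn' : (1 : ℝ) ≤ n := by exact_mod_cast hn
  have h := exp_neg_le_inv_pow_four hn hlow hc
  calc (n : ℝ) * Real.exp (-c) ≤ n * (1 / (n : ℝ) ^ 4) := by gcongr
    _ = 1 / (n : ℝ) ^ 3 := by field_simp
    _ ≤ 1 / (n : ℝ) ^ 1 := by gcongr; norm_num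
    _ = 1 / (n : ℝ) := by rw [pow_one]

theorem sum_Icc_pow_le_inv (hn : 1 ≤ n) (hlow : 24576 * Real.log n ≤ n * p) {c : ℝ}
    (hc : n * p / 48 ≤ c) :
    ∑ w ∈ Finset.Icc 1 n, ((n : ℝ) ^ 2 * Real.exp (-c)) ^ w ≤ 1 / (n : ℝ) := by
  have hn' : (1 : ℝ) ≤ n := by exact_mod_cast hn
  have hx : (n : ℝ) ^ 2 * Real.exp (-c) ≤ 1 / (n : ℝ) ^ 2 := by
    calc (n : ℝ) ^ 2 * Real.exp (-c) ≤ (n : ℝ) ^ 2 * (1 / (n : ℝ) ^ 4) := by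
          gcongr; exact exp_neg_le_inv_pow_four hn hlow hc
      _ = 1 / (n : ℝ) ^ 2 := by field_simp
  have hx1 : (n : ℝ) ^ 2 * Real.exp (-c) ≤ 1 :=
    hx.trans (by rw [div_le_one (by positivity)]; exact one_le_pow₀ hn')
  calc ∑ w ∈ Finset.Icc 1 n, ((n : ℝ) ^ 2 * Real.exp (-c)) ^ w
      ≤ ∑ w ∈ Finset.Icc 1 n, 1 / (n : ℝ) ^ 2 := Finset.sum_le_sum fun w hw =>
        (pow_le_of_le_one (by positivity) hx1 (by have := Finset.mem_Icc.1 hw; omega)).trans hx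
    _ = 1 / (n : ℝ) := by
        rw [Finset.sum_const, Nat.card_Icc, nsmul_eq_mul, Nat.add_sub_cancel]
        field_simp

end Estimates

/-- The exceptional probability is bounded in terms of `1 / n` and `n² p³`: the failure of degrees
and expansion costs `1 / n` for each property, the triangle count and `K₄` cost multiples of
`n² p³`. -/
theorem binomialRandom_real_not_isGoodForColoring_le {n : ℕ} (p : I) (hn : 24 ≤ n)
    (hlow : 24576 * Real.log n ≤ n * p) (hup : 2000 * ((n : ℝ) ^ 2 * (p : ℝ) ^ 3) ≤ 1) :
    (binomialRandom (Fin n) p).real {G | ¬ G.IsGoodForColoring} ≤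
      5 / (n : ℝ) + 100 * ((n : ℝ) ^ 2 * (p : ℝ) ^ 3) := by
  classical
  have hp0 : (0 : ℝ) ≤ p := p.2.1
  have hn' : (24 : ℝ) ≤ n := by exact_mod_cast hn
  have hn1 : 1 ≤ n := by omega
  have he := Real.exp_one_lt_d9
  have he0 := Real.exp_pos 1
  have hlog1 : 1 ≤ Real.log n := by
    rw [Real.le_log_iff_exp_le (by linarith)]
    linarith
  set d : ℝ := n * p with hd
  set x : ℝ := (n : ℝ) ^ 2 * (p : ℝ) ^ 3 with hx
  have hx0 : 0 ≤ x := by positivity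
  have hd0 : 24576 ≤ d := by linarith
  -- two disjoint reserved sets of a third of the vertices each
  obtain ⟨P₀, -, hP₀⟩ := Finset.exists_subset_card_eq (s := (Finset.univ : Finset (Fin n)))
    (n := n / 3) (by simp; omega)
  obtain ⟨P₁, hP₁', hP₁⟩ := Finset.exists_subset_card_eq (s := P₀ᶜ) (n := n / 3) (by
    rw [Finset.card_compl, Fintype.card_fin, hP₀]; omega)
  have hP : Disjoint P₀ P₁ := Finset.disjoint_left.2 fun v hv hv' =>
    Finset.mem_compl.1 (hP₁' hv') hv
  -- a matching that covers more than `d / 16` neighbours of `v` has at least `m₂` triangles that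
  -- meet the neighbourhood, as each triangle covers at most three of them
  set m₂ := ⌈d / 48⌉₊ with hm₂
  have hm₂0 : 0 < m₂ := Nat.ceil_pos.2 (by linarith)
  have hm₂' : d / 48 ≤ m₂ := Nat.le_ceil _
  set m₅ := n / 30 + 1 with hm₅
  have hm₅' : (n : ℝ) / 30 ≤ m₅ := by
    have : n ≤ 30 * m₅ := by omega
    have : (n : ℝ) ≤ 30 * m₅ := by exact_mod_cast this
    linarith
  let B₀ : Set (SimpleGraph (Fin n)) := {G | ∃ v, (G.degreeIn v P₀ : ℝ) ≤ d / 8}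
  let B₁ : Set (SimpleGraph (Fin n)) := {G | ∃ v, (G.degreeIn v P₁ : ℝ) ≤ d / 8}
  let B₂ : Set (SimpleGraph (Fin n)) := {G | ∃ v M, G.IsTriangleMatching M ∧ (∀ T ∈ M, v ∉ T) ∧
      d / 16 < G.degreeIn v (M.biUnion id)}
  let B₃ : Set (SimpleGraph (Fin n)) := {G | ∃ W N : Finset (Fin n), Disjoint W N ∧ W.Nonempty ∧
      N.card ≤ W.card ∧ (W.card : ℝ) ≤ n / 64 ∧ ∀ w ∈ W, d / 16 < G.degreeIn w N}
  let B₄ : Set (SimpleGraph (Fin n)) := {G | ∃ X Y : Finset (Fin n), Disjoint X Y ∧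
      (n : ℝ) / 64 ≤ X.card ∧ (n : ℝ) / 64 ≤ Y.card ∧ ∀ x ∈ X, ∀ y ∈ Y, ¬ G.Adj x y}
  let B₅ : Set (SimpleGraph (Fin n)) := {G | ∃ M, G.IsTriangleMatching M ∧ m₅ ≤ M.card}
  let B₆ : Set (SimpleGraph (Fin n)) := {G | ¬ G.CliqueFree 4}
  have hsub : {G : SimpleGraph (Fin n) | ¬ G.IsGoodForColoring} ⊆
      B₀ ∪ B₁ ∪ B₂ ∪ B₃ ∪ B₄ ∪ B₅ ∪ B₆ := by
    intro G hG
    by_contra hB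
    simp only [Set.mem_union, not_or, B₀, B₁, B₂, B₃, B₄, B₅, B₆, Set.mem_ofPred_eq] at hB
    obtain ⟨⟨⟨⟨⟨⟨h0, h1⟩, h2⟩, h3⟩, h4⟩, h5⟩, h6⟩ := hB
    push Not at h0 h1 h2 h3 h4 h5 h6
    refine hG ⟨h6, fun S hS => ?_⟩
    refine hasNearPerfectMatching_induce_of_expansion (a := d / 16) (r := n / 64) hP
      (by rw [Fintype.card_fin]; omega) (by rw [Fintype.card_fin]; omega)
      (fun v => by linarith [h0 v]) (fun v => by linarith [h1 v])
      (fun M hM v hv => h2 v M hM hv) (fun M hM => ?_) (fun W N hd hne hc hr => ?_)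
      (fun X Y hd hX hY => h4 X Y hd hX hY) hS
    · have := h5 M hM
      rw [Fintype.card_fin]; omega
    · exact h3 W N hd hne hc hr
  have hPcard : (n : ℝ) / 4 ≤ (n / 3 : ℕ) - 1 := by
    have : n ≤ 3 * (n / 3) + 2 := by omega
    have : (n : ℝ) ≤ 3 * (n / 3 : ℕ) + 2 := by exact_mod_cast this
    linarith
  have hpP : d / 4 ≤ p * (((n / 3 : ℕ) : ℝ) - 1) := by
    have := mul_le_mul_of_nonneg_left hPcard hp0
    linarith
  have b01 : ∀ P : Finset (Fin n), P.card = n / 3 →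
      (binomialRandom (Fin n) p).real {G | ∃ v, (G.degreeIn v P : ℝ) ≤ d / 8} ≤ 1 / (n : ℝ) := by
    intro P hPc
    have h := binomialRandom_real_exists_degreeIn_le p P (d / 8)
    rw [Fintype.card_fin, hPc, ← neg_sub] at h
    exact h.trans (mul_exp_neg_le_inv hn1 hlow (by linarith))
  have b0 : (binomialRandom (Fin n) p).real B₀ ≤ 1 / (n : ℝ) := b01 P₀ hP₀
  have b1 : (binomialRandom (Fin n) p).real B₁ ≤ 1 / (n : ℝ) := b01 P₁ hP₁
  have b2 : (binomialRandom (Fin n) p).real B₂ ≤ 1 / (n : ℝ) := by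
    have h := binomialRandom_real_exists_degreeIn_isTriangleMatching_le (V := Fin n) p
      (a := d / 16) hm₂0 (fun k hk => Nat.ceil_le.2 (by linarith))
    rw [Fintype.card_fin] at h
    refine h.trans (le_trans ?_ (mul_exp_neg_le_inv hn1 hlow le_rfl))
    gcongr
    have hbase : Real.exp 1 * (3 * (n : ℝ) ^ 3 * (p : ℝ) ^ 4) / m₂ ≤ Real.exp (-1) := by
      have h1 : (3 : ℝ) * (n : ℝ) ^ 3 * (p : ℝ) ^ 4 = 3 * (d * x) := by rw [hd, hx]; ring
      rw [h1, div_le_iff₀ (by exact_mod_cast hm₂0), Real.exp_neg, ← div_eq_inv_mul,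
        le_div_iff₀ he0]
      have h2 : Real.exp 1 * Real.exp 1 ≤ 9 := by nlinarith
      have h3 : 0 ≤ d * x := by positivity
      have h4 : d * x ≤ d * (1 / 2000) := by gcongr; linarith
      nlinarith
    calc _ ≤ Real.exp (-1) ^ m₂ := by gcongr
      _ = Real.exp (-m₂) := by rw [← Real.exp_nat_mul]; ring_nf
      _ ≤ _ := Real.exp_le_exp.2 (by linarith)
  have b3 : (binomialRandom (Fin n) p).real B₃ ≤ 1 / (n : ℝ) := by
    have h := binomialRandom_real_exists_dense_pair_le (V := Fin n) p (a := d / 16)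
      (r := n / 64) (by rw [Fintype.card_fin]; linarith)
    have h1 : -(d / 16) + 2 * (p * ((n : ℝ) / 64)) = -(d / 32) := by rw [hd]; ring
    rw [Fintype.card_fin, h1] at h
    exact h.trans (sum_Icc_pow_le_inv hn1 hlow (by linarith))
  have b4 : (binomialRandom (Fin n) p).real B₄ ≤ 1 / (n : ℝ) := by
    have h := binomialRandom_real_exists_forall_not_adj_le (V := Fin n) p (r := n / 64)
      (by positivity)
    rw [Fintype.card_fin] at h
    refine h.trans ?_
    -- the `4 ^ n` pairs of sets account for the size of the constant in the lower bound on `d`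
    have h1 : (4 : ℝ) ≤ Real.exp 2 := by
      have := Real.exp_one_gt_d9
      have h2 : Real.exp 2 = Real.exp 1 * Real.exp 1 := by rw [← Real.exp_add]; norm_num
      nlinarith
    have h3 : (p : ℝ) * ((n : ℝ) / 64) ^ 2 = n * d / 4096 := by rw [hd]; ring
    have h4 : (n : ℝ) * 24576 ≤ n * d := by gcongr
    calc (4 : ℝ) ^ n * Real.exp (-(63 / 100 * (p * ((n : ℝ) / 64) ^ 2)))
        ≤ Real.exp 2 ^ n * Real.exp (-(63 / 100 * (p * ((n : ℝ) / 64) ^ 2))) := by gcongr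
      _ = Real.exp (n * 2 - 63 / 100 * (n * d / 4096)) := by
          rw [h3, ← Real.exp_nat_mul, ← Real.exp_add, sub_eq_add_neg]
      _ ≤ Real.exp (-n) := Real.exp_le_exp.2 (by linarith)
      _ ≤ 1 / (n : ℝ) := by
          rw [Real.exp_neg, ← one_div]
          gcongr
          linarith [Real.add_one_le_exp (n : ℝ)]
  have b5 : (binomialRandom (Fin n) p).real B₅ ≤ 90 * x := by
    have h := binomialRandom_real_exists_isTriangleMatching_le (V := Fin n) p
      (m := m₅) (Nat.succ_pos _)
    rw [Fintype.card_fin] at h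
    have hbase : Real.exp 1 * ((n : ℝ) ^ 3 * (p : ℝ) ^ 3) / m₅ ≤ 90 * x := by
      have h1 : (n : ℝ) ^ 3 * (p : ℝ) ^ 3 = n * x := by rw [hx]; ring
      rw [h1, div_le_iff₀ (by positivity)]
      have h2 : Real.exp 1 * (n * x) ≤ 3 * (n * x) := by gcongr; linarith
      have h3 : x * ((n : ℝ) / 30) ≤ x * m₅ := by gcongr
      linarith
    exact h.trans ((pow_le_of_le_one (by positivity) (by linarith) (Nat.succ_ne_zero _)).trans
      hbase)
  have b6 : (binomialRandom (Fin n) p).real B₆ ≤ 3 * x := by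
    have h := binomialRandom_real_not_cliqueFree_four_le (V := Fin n) p
    rw [Fintype.card_fin] at h
    have h1 : (n : ℝ) ^ 4 * (p : ℝ) ^ 6 = x * x := by rw [hx]; ring
    rw [h1] at h
    refine h.trans ?_
    have h2 : x * x ≤ x * 1 := by gcongr; linarith
    nlinarith
  have hu : (binomialRandom (Fin n) p).real (B₀ ∪ B₁ ∪ B₂ ∪ B₃ ∪ B₄ ∪ B₅ ∪ B₆) ≤
      5 / (n : ℝ) + 100 * x := by
    have u1 := measureReal_union_le (μ := binomialRandom (Fin n) p)
      (B₀ ∪ B₁ ∪ B₂ ∪ B₃ ∪ B₄ ∪ B₅) B₆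
    have u2 := measureReal_union_le (μ := binomialRandom (Fin n) p) (B₀ ∪ B₁ ∪ B₂ ∪ B₃ ∪ B₄) B₅
    have u3 := measureReal_union_le (μ := binomialRandom (Fin n) p) (B₀ ∪ B₁ ∪ B₂ ∪ B₃) B₄
    have u4 := measureReal_union_le (μ := binomialRandom (Fin n) p) (B₀ ∪ B₁ ∪ B₂) B₃
    have u5 := measureReal_union_le (μ := binomialRandom (Fin n) p) (B₀ ∪ B₁) B₂
    have u6 := measureReal_union_le (μ := binomialRandom (Fin n) p) B₀ B₁
    have h5 : 5 / (n : ℝ) = 5 * (1 / (n : ℝ)) := by ring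
    linarith
  exact (measureReal_mono hsub (measure_ne_top _ _)).trans hu

theorem tendsto_binomialRandom_isGoodForColoring (q : ℕ → I)
    (hq_lower : (fun n : ℕ => Real.log n / n) =o[atTop] fun n : ℕ => (q n : ℝ))
    (hq_upper : (fun n : ℕ => (q n : ℝ)) =o[atTop] fun n : ℕ => (n : ℝ) ^ (-(2 / 3) : ℝ)) :
    Tendsto (fun n : ℕ => binomialRandom (Fin n) (q n) {G | G.IsGoodForColoring})
      atTop (𝓝 1) := by
  have hx : Tendsto (fun n : ℕ => (n : ℝ) ^ 2 * (q n : ℝ) ^ 3) atTop (𝓝 0) := by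
    have h := (hq_upper.tendsto_div_nhds_zero).pow 3
    rw [zero_pow three_ne_zero] at h
    refine h.congr fun n => ?_
    have hn : (0 : ℝ) ≤ n := Nat.cast_nonneg n
    have h1 : ((n : ℝ) ^ (-(2 / 3) : ℝ)) ^ 3 = ((n : ℝ) ^ 2)⁻¹ := by
      rw [← Real.rpow_natCast, ← Real.rpow_mul hn]
      norm_num
    rw [div_pow, h1, div_inv_eq_mul, mul_comm]
  have hlow : ∀ᶠ n : ℕ in atTop, 24576 * Real.log n ≤ n * (q n : ℝ) := by
    filter_upwards [hq_lower.bound (show (0 : ℝ) < 1 / 24576 by norm_num),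
      eventually_gt_atTop 0] with n hb hn
    have hn' : (0 : ℝ) < n := by exact_mod_cast hn
    rw [Real.norm_of_nonneg (div_nonneg (Real.log_natCast_nonneg n) hn'.le),
      Real.norm_of_nonneg (q n).2.1, div_le_iff₀ hn'] at hb
    linarith
  have hup : ∀ᶠ n : ℕ in atTop, 2000 * ((n : ℝ) ^ 2 * (q n : ℝ) ^ 3) ≤ 1 := by
    filter_upwards [hx.eventually (Iic_mem_nhds (show (0 : ℝ) < 1 / 2000 by norm_num))] with n h
    have : (n : ℝ) ^ 2 * (q n : ℝ) ^ 3 ≤ 1 / 2000 := h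
    linarith
  have hbound : Tendsto (fun n : ℕ => 5 / (n : ℝ) + 100 * ((n : ℝ) ^ 2 * (q n : ℝ) ^ 3))
      atTop (𝓝 0) := by
    simpa using (tendsto_const_div_atTop_nhds_zero_nat 5).add (hx.const_mul 100)
  have hbad : Tendsto (fun n : ℕ => (binomialRandom (Fin n) (q n)).real
      {G | ¬ G.IsGoodForColoring}) atTop (𝓝 0) := by
    refine tendsto_of_tendsto_of_tendsto_of_le_of_le' tendsto_const_nhds hbound
      (Eventually.of_forall fun n => measureReal_nonneg) ?_
    filter_upwards [hlow, hup, eventually_ge_atTop 24] with n h1 h2 h3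
    exact binomialRandom_real_not_isGoodForColoring_le (q n) h3 h1 h2
  have hgood := ENNReal.tendsto_ofReal ((tendsto_const_nhds (x := (1 : ℝ))).sub hbad)
  rw [sub_zero, ENNReal.ofReal_one] at hgood
  refine hgood.congr fun n => ?_
  have h := probReal_compl_eq_one_sub (μ := binomialRandom (Fin n) (q n))
    (s := {G | ¬ G.IsGoodForColoring}) (Set.toFinite _).measurableSet
  rw [← h, ofReal_measureReal]
  congr 1
  ext G
  simp

end SimpleGraph

theorem mainTheorem1
    (q : ℕ → unitInterval)
    (hq_lower : (fun n : ℕ => Real.log n / n) =o[atTop] fun n : ℕ => (q n : ℝ))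
    (hq_upper : (fun n : ℕ => (q n : ℝ)) =o[atTop] fun n : ℕ => (n : ℝ) ^ (-(2 / 3) : ℝ))
    -- an arbitrary deterministic rule choosing the vertex set of a maximum triangle-matching
    (S : (n : ℕ) → SimpleGraph (Fin n) → Set (Fin n))
    (hS : ∀ (n : ℕ) (G : SimpleGraph (Fin n)), G.IsMaximumTriangleMatchingVerts (S n G)) :
    -- for `G ∼ G(n, q)`, with high probability `G - S(G)` has a near-perfect matching
    Tendsto (fun n : ℕ => SimpleGraph.binomialRandom (Fin n) (q n)
        {G | (G.induce (S n G)ᶜ).HasNearPerfectMatching}) atTop (𝓝 1) ∧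
    -- for `H ∼ G(n, 1 - q)` with complement `G = Hᶜ`, with high probability
    -- `χ(H) = ⌈(n - s(G)) / 2⌉`
    Tendsto (fun n : ℕ => SimpleGraph.binomialRandom (Fin n) (unitInterval.symm (q n))
        {H | H.chromaticNumber =
          ((⌈((n : ℝ) - (Hᶜ.triangleMatchingNumber : ℝ)) / 2⌉₊ : ℕ) : ℕ∞)}) atTop (𝓝 1) := by
  have hgood := SimpleGraph.tendsto_binomialRandom_isGoodForColoring q hq_lower hq_upper
  refine ⟨?_, ?_⟩
  · exact tendsto_of_tendsto_of_tendsto_of_le_of_le hgood tendsto_const_nhds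
      (fun n => MeasureTheory.measure_mono fun G hG => hG.2 _ (hS n G))
      (fun n => MeasureTheory.prob_le_one)
  · refine tendsto_of_tendsto_of_tendsto_of_le_of_le hgood tendsto_const_nhds
      (fun n => ?_) (fun n => MeasureTheory.prob_le_one)
    change SimpleGraph.binomialRandom (Fin n) (q n) {G | G.IsGoodForColoring} ≤
      SimpleGraph.binomialRandom (Fin n) (unitInterval.symm (q n)) _
    rw [← SimpleGraph.binomialRandom_symm_compl]
    refine MeasureTheory.measure_mono fun H hH => ?_
    have h := SimpleGraph.chromaticNumber_compl_eq hH.1 (hS n Hᶜ) (hH.2 _ (hS n Hᶜ))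
    rwa [compl_compl, Fintype.card_fin] at h
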